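/- Let $V,W:\mathbb R\to\mathbb R$ be measurable with $V(-x)=V(x)$ and $W(-x)=-W(x)$ for all $x$, and $|W(x)|\le Ce^{-\kappa|x|}$ for some $C,\kappa>0$; let $\gamma,\mu\in\mathbb R$ and $g\in\{1,-1\}$. Let $L_0$ be a self-adjoint realization of $-\partial_x^2+V$ in $L^2(\mathbb R)$ with dense domain $D(L_0)$ (that is, $L_0$ is self-adjoint, and for $f\in D(L_0)$ the function $Vf$ is locally integrable and $L_0f=-f''+Vf$ in the sense of distributions), and let $D(L_0)$ be invariant under $f(x)\mapsto\overline{f(-x)}$. Let $\Phi\in D(L_0)$ satisfy $-\Phi''+(V+i\gamma W)\Phi-g|\Phi|^2\Phi=\mu\Phi$, $\Phi(x)=\overline{\Phi(-x)}$ and $|\Phi(x)|\le Ce^{-\kappa|x|}$ for almost every $x$, for some $C,\kappa>0$. On $D(L_0)\times D(L_0)\subset L^2(\mathbb R)\times L^2(\mathbb R)$ put $$\mathcal L=\begin{pmatrix}L_0+i\gamma W-\mu-2g|\Phi|^2&-g\Phi^2\\-g\overline\Phi^2&L_0-i\gamma W-\mu-2g|\Phi|^2\end{pmatrix},\qquad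 \mathcal L^*=\begin{pmatrix}L_0-i\gamma W-\mu-2g|\Phi|^2&-g\Phi^2\\-g\overline\Phi^2&L_0+i\gamma W-\mu-2g|\Phi|^2\end{pmatrix},$$ and $\sigma_3=\mathrm{diag}(1,-1)$. Let $\lambda_0\in\mathbb C\setminus\{0\}$ be a simple isolated eigenvalue of both $i\sigma_3\mathcal L$ and $i\sigma_3\mathcal L^*$ (an eigenvalue that is an isolated point of the spectrum and has a Riesz spectral projection of rank one), and let $v_0=(Y,Z)$ and $v_0^\#=(Y^\#,Z^\#)$ in $D(L_0)\times D(L_0)$ be nonzero with $\mathcal Lv_0=-i\lambda_0\sigma_3v_0$ and $\mathcal L^*v_0^\#=-i\lambda_0\sigma_3v_0^\#$. Define the Krein quantity $$K(\lambda_0)=\langle v_0,\sigma_3v_0^\#\rangle=\int_{\mathbb R}\bigl[Y\,\overline{Y^\#}-Z\,\overline{Z^\#}\bigr]\,dx .$$ Call an element $(f_1,f_2)$ of $L^2(\mathbb R)\times L^2(\mathbb R)$ $\mathcal{PT}$-symmetric if $f_j(x)=\overline{f_j(-x)}$ for almost every $x$, $j=1,2$. 1. If $\lambda_0\in i\mathbb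 R\setminus\{0\}$, then each of $v_0$, $v_0^\#$ becomes $\mathcal{PT}$-symmetric after multiplication by a suitable complex constant of modulus one, and $K(\lambda_0)$ is real whenever $v_0$ and $v_0^\#$ are so normalised, i.e. both $\mathcal{PT}$-symmetric. 2. If $\lambda_0\in i\mathbb R\setminus\{0\}$, then $K(\lambda_0)\neq0$ (with or without this normalisation). 3. If $\lambda_0\notin i\mathbb R$, then $K(\lambda_0)=0$. -/

import Mathlib

open MeasureTheory Complex
open scoped ENNReal ContDiff ComplexConjugate

noncomputable section

namespace KreinPT

/-- The complex Hilbert space `L²(ℝ)`. -/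
abbrev L2 : Type := Lp ℂ 2 (volume : Measure ℝ)

/-! ### Spectral notions for a partially defined operator on a complex normed space -/

section Spectral

variable {E : Type*} [NormedAddCommGroup E] [NormedSpace ℂ E]

/-- `R` is a bounded two-sided inverse of `z - A : D(A) → E`. -/
def IsResolventAt (A : E →ₗ.[ℂ] E) (z : ℂ) (R : E →L[ℂ] E) : Prop :=
  (∀ x : E, ∃ h : R x ∈ A.domain, z • R x - A ⟨R x, h⟩ = x) ∧
    ∀ y : A.domain, R (z • (y : E) - A y) = y

/-- The resolvent set of `A`. Its complement is the spectrum of `A`. -/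
def resolventSet (A : E →ₗ.[ℂ] E) : Set ℂ :=
  {z | ∃ R : E →L[ℂ] E, IsResolventAt A z R}

open scoped Classical in
/-- The resolvent `(z - A)⁻¹` for `z` in the resolvent set (and `0` otherwise). -/
def resolvent (A : E →ₗ.[ℂ] E) (z : ℂ) : E →L[ℂ] E :=
  if h : ∃ R : E →L[ℂ] E, IsResolventAt A z R then h.choose else 0

theorem resolvent_spec {A : E →ₗ.[ℂ] E} {z : ℂ} (hz : z ∈ resolventSet A) :
    IsResolventAt A z (resolvent A z) := by
  have h : ∃ R : E →L[ℂ] E, IsResolventAt A z R := hz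
  unfold resolvent
  rw [dif_pos h]
  exact h.choose_spec

/-- The Riesz spectral projection `(2πi)⁻¹ ∮_{|z - z₀| = r} (z - A)⁻¹ dz`. -/
def rieszProjection (A : E →ₗ.[ℂ] E) (z₀ : ℂ) (r : ℝ) : E →L[ℂ] E :=
  (2 * Real.pi * I : ℂ)⁻¹ • ∮ z in C(z₀, r), resolvent A z

/-- `z₀` is an eigenvalue of `A`, it is an isolated point of the spectrum of `A`, and its
algebraic multiplicity (the rank of the Riesz projection on a circle around `z₀` that encloses no
other point of the spectrum) is one. -/
def IsSimpleIsolatedEigenvalue (A : E →ₗ.[ℂ] E) (z₀ : ℂ) : Prop :=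
  (∃ y : A.domain, (y : E) ≠ 0 ∧ A y = z₀ • (y : E)) ∧
    ∃ r : ℝ, 0 < r ∧ (∀ z : ℂ, z ≠ z₀ → ‖z - z₀‖ ≤ r → z ∈ resolventSet A) ∧
      Module.finrank ℂ (LinearMap.range (rieszProjection A z₀ r : E →ₗ[ℂ] E)) = 1

end Spectral

/-! ### Multiplication operators, `PT` symmetry, Schrödinger operators -/

open scoped Classical in
/-- Multiplication by an essentially bounded function `w` on `L²(ℝ)`
(and `0` if `w` is not essentially bounded). -/
def mulOp (w : ℝ → ℂ) : L2 →L[ℂ] L2 :=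
  if h : MemLp w ∞ (volume : Measure ℝ) then
    (ContinuousLinearMap.mul ℂ ℂ).holderL volume ∞ 2 2 (h.toLp w)
  else 0

theorem mulOp_coe {w : ℝ → ℂ} (h : MemLp w ∞ (volume : Measure ℝ)) (f : L2) :
    (mulOp w f : ℝ → ℂ) =ᵐ[volume] fun x => w x * f x := by
  unfold mulOp
  rw [dif_pos h]
  filter_upwards [(ContinuousLinearMap.mul ℂ ℂ).coeFn_holder (r := 2) (h.toLp w) f,
    h.coeFn_toLp] with x hx hw
  simp only [ContinuousLinearMap.holderL_apply_apply]
  rw [hx, hw]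
  rfl

/-- `f` is `PT`-symmetric: `f(x) = conj f(-x)` for almost every `x`. -/
def PTSymmetric (f : L2) : Prop :=
  ∀ᵐ x : ℝ, f x = conj (f (-x))

/-- The `PT` transform `x ↦ conj f(-x)` of each `f ∈ D` lies in `D`. -/
def PTInvariant (D : Submodule ℂ L2) : Prop :=
  ∀ f ∈ D, ∀ h : L2, (∀ᵐ x : ℝ, h x = conj (f (-x))) → h ∈ D

/-- `L₀` is a self-adjoint realization of `-∂ₓ² + V` in `L²(ℝ)`: it is densely defined and
self-adjoint, and `L₀ f = -f'' + V f` in the sense of distributions for every `f ∈ D(L₀)`. -/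
structure IsSchrodingerOperator (V : ℝ → ℝ) (L₀ : L2 →ₗ.[ℂ] L2) : Prop where
  dense_domain : Dense (L₀.domain : Set L2)
  selfAdjoint : IsSelfAdjoint L₀
  locallyIntegrable : ∀ f : L₀.domain,
    LocallyIntegrable (fun x : ℝ => (V x : ℂ) * (f : L2) x) volume
  weak_eq : ∀ f : L₀.domain, ∀ φ : ℝ → ℂ, ContDiff ℝ ∞ φ → HasCompactSupport φ →
    ∫ x : ℝ, (L₀ f) x * φ x =
      ∫ x : ℝ, ((f : L2) x * (-(deriv (deriv φ) x)) + (V x : ℂ) * (f : L2) x * φ x)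

/-- `Φ ∈ D(L₀)` is a bounded, exponentially decaying, `PT`-symmetric solution of
`-Φ'' + (V + iγW) Φ - g|Φ|²Φ = μΦ`, where `L₀ = -∂ₓ² + V`. -/
structure IsStationaryState (L₀ : L2 →ₗ.[ℂ] L2) (W : ℝ → ℝ) (γ μ g : ℝ) (Φ : L2) : Prop where
  solves : ∃ h : Φ ∈ L₀.domain, ∀ᵐ x : ℝ,
    (L₀ ⟨Φ, h⟩) x + I * (γ : ℂ) * (W x : ℂ) * Φ x - (g : ℂ) * ((‖Φ x‖ ^ 2 : ℝ) : ℂ) * Φ x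
      = (μ : ℂ) * Φ x
  symm : PTSymmetric Φ
  decay : ∃ C κ : ℝ, 0 < C ∧ 0 < κ ∧ ∀ᵐ x : ℝ, ‖Φ x‖ ≤ C * Real.exp (-κ * |x|)

/-! ### The linearization -/

/-- The diagonal potential `iγW - μ - 2g|Φ|²`. -/
def diagPotential (W : ℝ → ℝ) (γ μ g : ℝ) (Φ : L2) : ℝ → ℂ :=
  fun x => I * (γ : ℂ) * (W x : ℂ) - (μ : ℂ) - 2 * (g : ℂ) * ((‖Φ x‖ ^ 2 : ℝ) : ℂ)

/-- The off-diagonal potential `-gΦ²`. -/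
def offDiagPotential (g : ℝ) (Φ : L2) : ℝ → ℂ :=
  fun x => -(g : ℂ) * Φ x ^ 2

/-- The operator on `D(L₀) × D(L₀) ⊆ L²(ℝ) × L²(ℝ)` with the matrix
`[L₀ + iγW - μ - 2g|Φ|², -gΦ²; -g(conj Φ)², L₀ - iγW - μ - 2g|Φ|²]`. -/
def jacobian (L₀ : L2 →ₗ.[ℂ] L2) (W : ℝ → ℝ) (γ μ g : ℝ) (Φ : L2) :
    (L2 × L2) →ₗ.[ℂ] (L2 × L2) where
  domain := L₀.domain.prod L₀.domain
  toFun :=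
    { toFun := fun v =>
        (L₀ ⟨v.1.1, v.2.1⟩ + mulOp (diagPotential W γ μ g Φ) v.1.1
            + mulOp (offDiagPotential g Φ) v.1.2,
         mulOp (fun x => conj (offDiagPotential g Φ x)) v.1.1
            + (L₀ ⟨v.1.2, v.2.2⟩ + mulOp (diagPotential W (-γ) μ g Φ) v.1.2))
      map_add' := fun u v => by
        have h1 := L₀.map_add ⟨u.1.1, u.2.1⟩ ⟨v.1.1, v.2.1⟩
        have h2 := L₀.map_add ⟨u.1.2, u.2.2⟩ ⟨v.1.2, v.2.2⟩
        simp only [AddMemClass.mk_add_mk] at h1 h2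
        ext1
        · simp only [Submodule.coe_add, Prod.fst_add, Prod.snd_add, map_add, h1]
          abel
        · simp only [Submodule.coe_add, Prod.fst_add, Prod.snd_add, map_add, h2]
          abel
      map_smul' := fun c u => by
        have h1 := L₀.map_smul c ⟨u.1.1, u.2.1⟩
        have h2 := L₀.map_smul c ⟨u.1.2, u.2.2⟩
        simp only [SetLike.mk_smul_mk] at h1 h2
        ext1
        · simp only [Submodule.coe_smul, Prod.smul_fst, Prod.smul_snd, map_smul, h1,
            RingHom.id_apply, smul_add]
        · simp only [Submodule.coe_smul, Prod.smul_fst, Prod.smul_snd, map_smul, h2,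
            RingHom.id_apply, smul_add] }

/-- The operator with the matrix
`[L₀ - iγW - μ - 2g|Φ|², -gΦ²; -g(conj Φ)², L₀ + iγW - μ - 2g|Φ|²]` (for the same `Φ`);
it arises from `jacobian` by reversing the sign of the terms `± iγW`. -/
def jacobianAdj (L₀ : L2 →ₗ.[ℂ] L2) (W : ℝ → ℝ) (γ μ g : ℝ) (Φ : L2) :
    (L2 × L2) →ₗ.[ℂ] (L2 × L2) :=
  jacobian L₀ W (-γ) μ g Φ

/-- The Pauli matrix `σ₃ = diag(1, -1)`. -/
def sigma3 : (L2 × L2) →ₗ[ℂ] (L2 × L2) :=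
  LinearMap.prodMap LinearMap.id (-LinearMap.id)

/-- The operator `iσ₃M`; thus `iσ₃M v = λ v` if and only if `M v = -iλσ₃ v`. -/
def stabilityOperator (M : (L2 × L2) →ₗ.[ℂ] (L2 × L2)) : (L2 × L2) →ₗ.[ℂ] (L2 × L2) :=
  (I • sigma3).compPMap M

/-- `v ∈ D(M)` is a nonzero solution of `M v = -iλσ₃ v`. -/
def IsEigenvector (M : (L2 × L2) →ₗ.[ℂ] (L2 × L2)) (lam : ℂ) (v : L2 × L2) : Prop :=
  v ≠ 0 ∧ ∃ h : v ∈ M.domain, M ⟨v, h⟩ = (-I * lam) • sigma3 v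

/-- The Krein quantity `⟨v, σ₃w⟩ = ∫ (Y conj Y' - Z conj Z') dx` of `v = (Y, Z)`,
`w = (Y', Z')`. -/
def kreinQuantity (v w : L2 × L2) : ℂ :=
  ∫ x : ℝ, (v.1 x * conj (w.1 x) - v.2 x * conj (w.2 x))

end KreinPT

end

/-!
The argument rests on two symmetries of the linearization `𝓛` and on the fact that a Riesz
projection of rank one has a one-dimensional range.

The `PT` transform `Θ f (x) = conj (f (-x))` commutes with `L₀`, since `V` is real and even and
the action of `L₀` is determined by its distributional expression
(`IsSchrodingerOperator.map_ptTransform`). As `W` is odd and `Φ` is `PT`-symmetric, it commutes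
with `𝓛` (`jacobian_ptTransform`). Being conjugate-linear, it maps the eigenspace of `iσ₃𝓛` at `λ`
to the one at `-conj λ`. For imaginary `λ` these agree, and the eigenspace is a line, so
`Θ v = c v` with `|c| = 1`; multiplication by a square root of `c` makes `v` symmetric
(`IsEigenvector.exists_ptSymmetric`).

Reversing the sign of `γ` turns `𝓛` into its formal adjoint (`inner_jacobian`). Hence `⟨·, σ₃w⟩` is
a left eigenvector of `iσ₃𝓛` with the eigenvalue `-conj λ` (`kreinFunctional_stabilityOperator`).
Evaluation at `v` gives `(λ + conj λ) K = 0`, so `K = 0` unless `λ` is imaginary. If `λ` is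
imaginary, `v` and `⟨·, σ₃w⟩` are a right and a left eigenvector at the same point, and the spectral
projection `P` satisfies `P v = v` and `⟨P u, σ₃w⟩ = ⟨u, σ₃w⟩`
(`IsSimpleIsolatedEigenvalue.exists_projection`). Since `v` spans the range of `P`, `K = 0` would
force `⟨u, σ₃w⟩ = 0` for every `u`, that is, `w = 0`.
-/

namespace KreinPT

/-! ### Riesz projections of rank one -/

section Spectral

variable {E : Type*} [NormedAddCommGroup E] [NormedSpace ℂ E] [CompleteSpace E]

/-- A nonzero Riesz projection is a convergent integral (a divergent one has the value `0`), so
bounded linear maps can be moved inside it. -/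
theorem map_rieszProjection {A : E →ₗ.[ℂ] E} {z₀ : ℂ} {r : ℝ} (hr : 0 < r)
    (hP : rieszProjection A z₀ r ≠ 0) {G : Type*} [NormedAddCommGroup G] [NormedSpace ℂ G]
    [CompleteSpace G] (T : (E →L[ℂ] E) →L[ℂ] G) (b : G)
    (h : ∀ z : ℂ, z ≠ z₀ → ‖z - z₀‖ ≤ r → T (resolvent A z) = (z - z₀)⁻¹ • b) :
    T (rieszProjection A z₀ r) = b := by
  have hint : CircleIntegrable (fun z => resolvent A z) z₀ r := by
    by_contra hn
    exact hP (by rw [rieszProjection, circleIntegral.integral_undef hn, smul_zero])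
  have h1 : T (∮ z in C(z₀, r), resolvent A z) = ∮ z in C(z₀, r), T (resolvent A z) := by
    have h2 := T.intervalIntegral_comp_comm hint.out
    simp only [circleIntegral, ← h2, map_smul]
  have h3 : (∮ z in C(z₀, r), T (resolvent A z)) = ∮ z in C(z₀, r), (z - z₀)⁻¹ • b := by
    refine circleIntegral.integral_congr hr.le fun z hz => ?_
    have hz' : ‖z - z₀‖ = r := by simpa [dist_eq_norm] using hz
    exact h z (fun h0 => by simp [h0] at hz'; exact hr.ne hz') hz'.le
  have h4 : (2 * Real.pi * I : ℂ) ≠ 0 := Complex.two_pi_I_ne_zero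
  rw [rieszProjection, map_smul, h1, h3, circleIntegral.integral_smul_const,
    circleIntegral.integral_sub_center_inv z₀ hr.ne', smul_smul, inv_mul_cancel₀ h4, one_smul]

/-- The projection of rank one fixes every eigenvector, and its transpose fixes every eigenvector
`l` of the transposed operator. -/
theorem IsSimpleIsolatedEigenvalue.exists_projection {A : E →ₗ.[ℂ] E} {z₀ : ℂ}
    (hA : IsSimpleIsolatedEigenvalue A z₀) :
    ∃ P : E →L[ℂ] E, Module.finrank ℂ (LinearMap.range (P : E →ₗ[ℂ] E)) = 1 ∧
      (∀ y : A.domain, A y = z₀ • (y : E) → P y = y) ∧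
      ∀ l : E →L[ℂ] ℂ, (∀ y : A.domain, l (A y) = z₀ * l y) → ∀ u, l (P u) = l u := by
  obtain ⟨-, r, hr, hres, hrank⟩ := hA
  have hP : rieszProjection A z₀ r ≠ 0 := by
    intro h0
    rw [h0, ContinuousLinearMap.toLinearMap_zero, LinearMap.range_zero, finrank_bot] at hrank
    exact zero_ne_one hrank
  refine ⟨rieszProjection A z₀ r, hrank, fun y hy => ?_, fun l hl u => ?_⟩
  · refine map_rieszProjection hr hP (ContinuousLinearMap.apply ℂ E (y : E)) (y : E)
      fun z hz hzr => ?_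
    have h := (resolvent_spec (hres z hz hzr)).2 y
    rw [hy, ← sub_smul, map_smul] at h
    rw [ContinuousLinearMap.apply_apply, eq_inv_smul_iff₀ (sub_ne_zero.2 hz), h]
  · refine map_rieszProjection hr hP (l.comp (ContinuousLinearMap.apply ℂ E u)) (l u)
      fun z hz hzr => ?_
    obtain ⟨hm, h⟩ := (resolvent_spec (hres z hz hzr)).1 u
    have h' := congrArg l h
    rw [map_sub, map_smul, hl, smul_eq_mul, ← sub_mul] at h'
    rw [ContinuousLinearMap.comp_apply, ContinuousLinearMap.apply_apply,
      eq_inv_smul_iff₀ (sub_ne_zero.2 hz), smul_eq_mul, h']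

/-- The eigenspace of a simple isolated eigenvalue is a line. -/
theorem IsSimpleIsolatedEigenvalue.exists_smul_eq {A : E →ₗ.[ℂ] E} {z₀ : ℂ}
    (hA : IsSimpleIsolatedEigenvalue A z₀) {y u : A.domain} (hy0 : (y : E) ≠ 0)
    (hy : A y = z₀ • (y : E)) (hu : A u = z₀ • (u : E)) : ∃ c : ℂ, c • (y : E) = u := by
  obtain ⟨P, hrank, hfix, -⟩ := hA.exists_projection
  obtain ⟨c, hc⟩ := (finrank_eq_one_iff_of_nonzero'
    (⟨y, ⟨y, hfix y hy⟩⟩ : LinearMap.range (P : E →ₗ[ℂ] E))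
    (fun h => hy0 (congrArg Subtype.val h))).1 hrank ⟨u, ⟨u, hfix u hu⟩⟩
  exact ⟨c, congrArg Subtype.val hc⟩

/-- Right and left eigenvectors of a simple isolated eigenvalue pair nontrivially: since the
projection has the range spanned by `y`, a functional that is invariant under it and vanishes
at `y` is zero. -/
theorem IsSimpleIsolatedEigenvalue.apply_ne_zero {A : E →ₗ.[ℂ] E} {z₀ : ℂ}
    (hA : IsSimpleIsolatedEigenvalue A z₀) {y : A.domain} (hy0 : (y : E) ≠ 0)
    (hy : A y = z₀ • (y : E)) {l : E →L[ℂ] ℂ} (hl0 : l ≠ 0)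
    (hl : ∀ u : A.domain, l (A u) = z₀ * l u) : l y ≠ 0 := by
  obtain ⟨P, hrank, hfix, hinv⟩ := hA.exists_projection
  intro h0
  refine hl0 (ContinuousLinearMap.ext fun u => ?_)
  obtain ⟨c, hc⟩ := (finrank_eq_one_iff_of_nonzero'
    (⟨y, ⟨y, hfix y hy⟩⟩ : LinearMap.range (P : E →ₗ[ℂ] E))
    (fun h => hy0 (congrArg Subtype.val h))).1 hrank ⟨P u, ⟨u, rfl⟩⟩
  have hc' : c • (y : E) = P u := congrArg Subtype.val hc
  rw [← hinv l hl u, ← hc', map_smul, h0, smul_zero, zero_apply]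

end Spectral

/-! ### The `PT` transform on `L²(ℝ)` -/

section PTTransform

theorem ae_comp_neg {p : ℝ → Prop} (h : ∀ᵐ x, p x) : ∀ᵐ x, p (-x) :=
  (Measure.measurePreserving_neg (volume : Measure ℝ)).quasiMeasurePreserving.ae h

theorem exists_ptTransform (f : L2) : ∃ h : L2, ∀ᵐ x : ℝ, h x = conj (f (-x)) := by
  have hm := Measure.measurePreserving_neg (volume : Measure ℝ)
  refine ⟨star (Lp.compMeasurePreserving Neg.neg hm f), ?_⟩
  filter_upwards [Lp.coeFn_star (Lp.compMeasurePreserving Neg.neg hm f),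
    Lp.coeFn_compMeasurePreserving f hm] with x h1 h2
  rw [h1, Pi.star_apply, h2]
  rfl

/-- The `PT` transform `f ↦ conj (f (-·))`, a conjugate-linear involution of `L²(ℝ)`. -/
noncomputable def ptTransform : L2 →ₗ⋆[ℂ] L2 where
  toFun f := (exists_ptTransform f).choose
  map_add' f h := by
    refine Lp.ext ?_
    filter_upwards [(exists_ptTransform (f + h)).choose_spec, (exists_ptTransform f).choose_spec,
      (exists_ptTransform h).choose_spec, ae_comp_neg (Lp.coeFn_add f h),
      Lp.coeFn_add (exists_ptTransform f).choose (exists_ptTransform h).choose]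
      with x h1 h2 h3 h4 h5
    rw [h1, h4, h5, Pi.add_apply, Pi.add_apply, h2, h3, map_add]
  map_smul' c f := by
    refine Lp.ext ?_
    filter_upwards [(exists_ptTransform (c • f)).choose_spec, (exists_ptTransform f).choose_spec,
      ae_comp_neg (Lp.coeFn_smul c f), Lp.coeFn_smul (conj c) (exists_ptTransform f).choose]
      with x h1 h2 h3 h4
    rw [h1, h3, h4, Pi.smul_apply, Pi.smul_apply, h2, smul_eq_mul, smul_eq_mul, map_mul]

theorem ptTransform_coe (f : L2) : ∀ᵐ x : ℝ, ptTransform f x = conj (f (-x)) :=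
  (exists_ptTransform f).choose_spec

theorem ptTransform_ptTransform (f : L2) : ptTransform (ptTransform f) = f := by
  refine Lp.ext ?_
  filter_upwards [ptTransform_coe (ptTransform f), ae_comp_neg (ptTransform_coe f)] with x h1 h2
  rw [h1, h2, neg_neg, Complex.conj_conj]

theorem ptSymmetric_iff {f : L2} : PTSymmetric f ↔ ptTransform f = f := by
  constructor
  · intro h
    refine Lp.ext ?_
    filter_upwards [h, ptTransform_coe f] with x h1 h2
    rw [h1, h2]
  · intro h
    have h1 := ptTransform_coe f
    rw [h] at h1
    exact h1

theorem mulOp_ptTransform {w : ℝ → ℂ} (h : MemLp w ∞ (volume : Measure ℝ))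
    (hw : ∀ᵐ x, w x = conj (w (-x))) (f : L2) :
    mulOp w (ptTransform f) = ptTransform (mulOp w f) := by
  refine Lp.ext ?_
  filter_upwards [mulOp_coe h (ptTransform f), ptTransform_coe f, ptTransform_coe (mulOp w f),
    ae_comp_neg (mulOp_coe h f), hw] with x h1 h2 h3 h4 h5
  rw [h1, h2, h3, h4, map_mul, ← h5]

end PTTransform

/-! ### The Schrödinger operator -/

/-- `L₀` commutes with the `PT` transform: `V` is real and even, and the action of `L₀` is
determined by its distributional expression. -/
theorem IsSchrodingerOperator.map_ptTransform {V : ℝ → ℝ} {L₀ : L2 →ₗ.[ℂ] L2}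
    (hL₀ : IsSchrodingerOperator V L₀) (hV : ∀ x, V (-x) = V x) (f : L₀.domain)
    (h : ptTransform f ∈ L₀.domain) : L₀ ⟨ptTransform f, h⟩ = ptTransform (L₀ f) := by
  have hloc (u : L2) : LocallyIntegrable (u : ℝ → ℂ) volume :=
    (Lp.memLp u).locallyIntegrable (by norm_num)
  refine Lp.ext (ae_eq_of_integral_contDiff_smul_eq (hloc _) (hloc _) fun φ hφ hφc => ?_)
  -- the test functions `φ` and `ψ = φ (-·)`, as complex-valued functions
  have hsm {η : ℝ → ℝ} (hη : ContDiff ℝ ∞ η) : ContDiff ℝ ∞ (fun x => (η x : ℂ)) :=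
    Complex.ofRealCLM.contDiff.comp hη
  have hsup {η : ℝ → ℝ} (hη : HasCompactSupport η) : HasCompactSupport (fun x => (η x : ℂ)) :=
    hη.comp_left Complex.ofReal_zero
  have hψ : ContDiff ℝ ∞ (fun x => φ (-x)) := hφ.comp contDiff_neg
  have hψc : HasCompactSupport (fun x => φ (-x)) := hφc.comp_homeomorph (Homeomorph.neg ℝ)
  have h1 := hL₀.weak_eq ⟨ptTransform f, h⟩ _ (hsm hφ) (hsup hφc)
  have h2 := congrArg conj (hL₀.weak_eq f _ (hsm hψ) (hsup hψc))
  rw [← integral_conj, ← integral_conj] at h2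
  have hd {η : ℝ → ℝ} (hη : ContDiff ℝ ∞ η) :
      deriv (deriv fun x => (η x : ℂ)) = fun x => ((deriv (deriv η) x : ℝ) : ℂ) := by
    have hη' : ContDiff ℝ ∞ (deriv η) := hη.iterate_deriv 1
    rw [show (deriv fun x => (η x : ℂ)) = fun x => ((deriv η x : ℝ) : ℂ) from
      funext fun x => ((hη.differentiable (by simp) x).hasDerivAt.ofReal_comp).deriv]
    exact funext fun x => ((hη'.differentiable (by simp) x).hasDerivAt.ofReal_comp).deriv
  have hdneg : deriv (deriv fun x => φ (-x)) = fun x => deriv (deriv φ) (-x) := by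
    have : (deriv fun x => φ (-x)) = fun x => -deriv φ (-x) :=
      funext fun x => deriv_comp_neg φ x
    rw [this]
    funext x
    rw [deriv.fun_neg, deriv_comp_neg (deriv φ) x, neg_neg]
  rw [hd hφ] at h1
  rw [hd hψ, hdneg, ← integral_neg_eq_self, ← integral_neg_eq_self (fun x => conj (_ + _))] at h2
  calc ∫ x, φ x • (L₀ ⟨ptTransform f, h⟩) x
      = ∫ x, (L₀ ⟨ptTransform f, h⟩) x * (φ x : ℂ) :=
        integral_congr_ae (.of_forall fun x => by simp [mul_comm])
    _ = _ := h1
    _ = _ := integral_congr_ae ?_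
    _ = _ := h2.symm
    _ = ∫ x, φ x • (ptTransform (L₀ f)) x := integral_congr_ae ?_
  · filter_upwards [ptTransform_coe (f : L2)] with x hx
    simp only [hx, hV, neg_neg, map_add, map_mul, map_neg, Complex.conj_ofReal]
  · filter_upwards [ptTransform_coe (L₀ f)] with x hx
    simp only [hx, neg_neg, map_mul, Complex.conj_ofReal, Complex.real_smul, mul_comm]

theorem IsSchrodingerOperator.inner_map {V : ℝ → ℝ} {L₀ : L2 →ₗ.[ℂ] L2}
    (hL₀ : IsSchrodingerOperator V L₀) (f h : L₀.domain) :
    inner ℂ (L₀ f) (h : L2) = inner ℂ (f : L2) (L₀ h) := by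
  have h1 := L₀.adjoint_isFormalAdjoint hL₀.dense_domain
  rw [LinearPMap.isSelfAdjoint_def.1 hL₀.selfAdjoint] at h1
  exact h1 f h

/-! ### Symmetries of the linearization -/

section Linearization

theorem memLp_top_of_le_exp {E : Type*} [NormedAddCommGroup E] {f : ℝ → E}
    (hf : AEStronglyMeasurable f volume)
    (h : ∃ C κ : ℝ, 0 < C ∧ 0 < κ ∧ ∀ᵐ x : ℝ, ‖f x‖ ≤ C * Real.exp (-κ * |x|)) :
    MemLp f ∞ volume := by
  obtain ⟨C, κ, hC, hκ, h⟩ := h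
  refine memLp_top_of_bound hf C ?_
  filter_upwards [h] with x hx
  refine hx.trans (mul_le_of_le_one_right hC.le (Real.exp_le_one_iff.2 ?_))
  rw [neg_mul]
  exact neg_nonpos.2 (by positivity)

variable {W : ℝ → ℝ} {Φ : L2}

theorem memLp_conj {w : ℝ → ℂ} (h : MemLp w ∞ volume) :
    MemLp (fun x => conj (w x)) ∞ (volume : Measure ℝ) := h.star

theorem memLp_offDiagPotential (hΦ : MemLp Φ ∞ volume) (g : ℝ) :
    MemLp (offDiagPotential g Φ) ∞ volume := by
  have h : MemLp (fun x => Φ x * Φ x) ∞ volume := hΦ.mul hΦ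
  refine (h.const_mul (-(g : ℂ))).ae_eq (.of_forall fun x => ?_)
  simp [offDiagPotential, pow_two]

theorem memLp_diagPotential (hW : MemLp W ∞ volume) (hΦ : MemLp Φ ∞ volume) (γ μ g : ℝ) :
    MemLp (diagPotential W γ μ g Φ) ∞ volume := by
  have h1 : MemLp (fun x => (W x : ℂ)) ∞ volume := hW.ofReal
  have h2 : MemLp (fun x => Φ x * conj (Φ x)) ∞ volume := (memLp_conj hΦ).mul hΦ
  have h3 := ((h1.const_mul (I * (γ : ℂ))).sub (memLp_top_const (μ : ℂ))).sub
    (h2.const_mul (2 * (g : ℂ)))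
  refine h3.ae_eq (.of_forall fun x => ?_)
  simp [diagPotential, Complex.mul_conj, Complex.normSq_eq_norm_sq]

theorem conj_diagPotential (γ μ g : ℝ) (x : ℝ) :
    conj (diagPotential W γ μ g Φ x) = diagPotential W (-γ) μ g Φ x := by
  simp [diagPotential, Complex.conj_ofNat]

theorem diagPotential_symm (hW : ∀ x, W (-x) = -W x) (hΦ : PTSymmetric Φ) (γ μ g : ℝ) :
    ∀ᵐ x, diagPotential W γ μ g Φ x = conj (diagPotential W γ μ g Φ (-x)) := by
  filter_upwards [hΦ] with x hx
  simp [diagPotential, hx, hW, Complex.conj_ofNat]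

theorem offDiagPotential_symm (hΦ : PTSymmetric Φ) (g : ℝ) :
    ∀ᵐ x, offDiagPotential g Φ x = conj (offDiagPotential g Φ (-x)) := by
  filter_upwards [hΦ] with x hx
  simp [offDiagPotential, hx]

theorem inner_mulOp {w : ℝ → ℂ} (h : MemLp w ∞ volume) (f u : L2) :
    inner ℂ f (mulOp w u) = inner ℂ (mulOp (fun x => conj (w x)) f) u := by
  rw [L2.inner_def, L2.inner_def]
  refine integral_congr_ae ?_
  filter_upwards [mulOp_coe h u, mulOp_coe (memLp_conj h) f] with x h1 h2
  simp only [h1, h2, RCLike.inner_apply, map_mul, Complex.conj_conj]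
  ring

variable {V : ℝ → ℝ} {L₀ : L2 →ₗ.[ℂ] L2} {γ μ g : ℝ}

/-- The linearization commutes with the `PT` transform acting on both components. -/
theorem jacobian_ptTransform (hL₀ : IsSchrodingerOperator V L₀) (hV : ∀ x, V (-x) = V x)
    (hPT : PTInvariant L₀.domain) (hWb : MemLp W ∞ volume) (hW : ∀ x, W (-x) = -W x)
    (hΦb : MemLp Φ ∞ volume) (hΦ : PTSymmetric Φ)
    (v : (jacobian L₀ W γ μ g Φ).domain) :
    ∃ h : (ptTransform v.1.1, ptTransform v.1.2) ∈ (jacobian L₀ W γ μ g Φ).domain,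
      jacobian L₀ W γ μ g Φ ⟨_, h⟩ = (ptTransform (jacobian L₀ W γ μ g Φ v).1,
        ptTransform (jacobian L₀ W γ μ g Φ v).2) := by
  obtain ⟨⟨y, z⟩, hy, hz⟩ := v
  have hy' := hPT y hy _ (ptTransform_coe y)
  have hz' := hPT z hz _ (ptTransform_coe z)
  have hconj : ∀ᵐ x, conj (offDiagPotential g Φ x) = conj (conj (offDiagPotential g Φ (-x))) :=
    (offDiagPotential_symm hΦ g).mono fun x hx => congrArg conj hx
  have h1 := hL₀.map_ptTransform hV ⟨y, hy⟩ hy'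
  have h2 := hL₀.map_ptTransform hV ⟨z, hz⟩ hz'
  refine ⟨⟨hy', hz'⟩, Prod.ext ?_ ?_⟩
  · change L₀ ⟨ptTransform y, hy'⟩ + mulOp _ (ptTransform y) + mulOp _ (ptTransform z)
      = ptTransform (L₀ ⟨y, hy⟩ + mulOp _ y + mulOp _ z)
    rw [map_add, map_add, h1,
      mulOp_ptTransform (memLp_diagPotential hWb hΦb γ μ g) (diagPotential_symm hW hΦ γ μ g),
      mulOp_ptTransform (memLp_offDiagPotential hΦb g) (offDiagPotential_symm hΦ g)]
  · change mulOp _ (ptTransform y) + (L₀ ⟨ptTransform z, hz'⟩ + mulOp _ (ptTransform z))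
      = ptTransform (mulOp _ y + (L₀ ⟨z, hz⟩ + mulOp _ z))
    rw [map_add, map_add, h2,
      mulOp_ptTransform (memLp_diagPotential hWb hΦb (-γ) μ g) (diagPotential_symm hW hΦ (-γ) μ g),
      mulOp_ptTransform (memLp_conj (memLp_offDiagPotential hΦb g)) hconj]

/-- Reversing the sign of `γ` turns the linearization into its formal adjoint. -/
theorem inner_jacobian (hL₀ : IsSchrodingerOperator V L₀) (hWb : MemLp W ∞ volume)
    (hΦb : MemLp Φ ∞ volume) (u : (jacobian L₀ W γ μ g Φ).domain)
    (w : (jacobianAdj L₀ W γ μ g Φ).domain) :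
    inner ℂ w.1.1 (jacobian L₀ W γ μ g Φ u).1 + inner ℂ w.1.2 (jacobian L₀ W γ μ g Φ u).2 =
      inner ℂ (jacobianAdj L₀ W γ μ g Φ w).1 u.1.1 +
        inner ℂ (jacobianAdj L₀ W γ μ g Φ w).2 u.1.2 := by
  obtain ⟨⟨y, z⟩, hy, hz⟩ := u
  obtain ⟨⟨y', z'⟩, hy', hz'⟩ := w
  change inner ℂ y' (L₀ ⟨y, hy⟩ + mulOp _ y + mulOp _ z) +
      inner ℂ z' (mulOp _ y + (L₀ ⟨z, hz⟩ + mulOp _ z)) =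
    inner ℂ (L₀ ⟨y', hy'⟩ + mulOp _ y' + mulOp _ z') y +
      inner ℂ (mulOp _ y' + (L₀ ⟨z', hz'⟩ + mulOp _ z')) z
  simp only [inner_add_left, inner_add_right]
  rw [inner_mulOp (memLp_diagPotential hWb hΦb γ μ g),
    inner_mulOp (memLp_diagPotential hWb hΦb (-γ) μ g),
    inner_mulOp (memLp_offDiagPotential hΦb g),
    inner_mulOp (memLp_conj (memLp_offDiagPotential hΦb g)),
    ← hL₀.inner_map ⟨y', hy'⟩ ⟨y, hy⟩, ← hL₀.inner_map ⟨z', hz'⟩ ⟨z, hz⟩]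
  simp only [conj_diagPotential, Complex.conj_conj]
  ring

end Linearization

/-! ### Eigenvectors and the Krein quantity -/

theorem sigma3_apply (v : L2 × L2) : sigma3 v = (v.1, -v.2) := rfl

theorem IsEigenvector.stabilityOperator_apply {M : (L2 × L2) →ₗ.[ℂ] (L2 × L2)} {lam : ℂ}
    {v : L2 × L2} (h : v ∈ M.domain) (hv : M ⟨v, h⟩ = (-I * lam) • sigma3 v) :
    stabilityOperator M ⟨v, h⟩ = lam • v := by
  change I • sigma3 (M ⟨v, h⟩) = lam • v
  have hI : I * (-I * lam) = lam := by linear_combination (-lam) * I_mul_I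
  rw [hv, map_smul, smul_smul, hI, sigma3_apply, sigma3_apply, neg_neg]

/-- An eigenvector for a purely imaginary simple eigenvalue is a unimodular multiple of its `PT`
transform, because the `PT` transform maps the eigenspace of `λ` to that of `-conj λ = λ`. -/
theorem IsEigenvector.exists_ptSymmetric {V W : ℝ → ℝ} {L₀ : L2 →ₗ.[ℂ] L2} {Φ : L2} {γ μ g : ℝ}
    (hL₀ : IsSchrodingerOperator V L₀) (hV : ∀ x, V (-x) = V x)
    (hPT : PTInvariant L₀.domain) (hWb : MemLp W ∞ volume) (hW : ∀ x, W (-x) = -W x)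
    (hΦb : MemLp Φ ∞ volume) (hΦ : PTSymmetric Φ) {lam : ℂ} (hlam : lam.re = 0)
    (hsimple : IsSimpleIsolatedEigenvalue (stabilityOperator (jacobian L₀ W γ μ g Φ)) lam)
    {v : L2 × L2} (hv : IsEigenvector (jacobian L₀ W γ μ g Φ) lam v) :
    ∃ c : ℂ, ‖c‖ = 1 ∧ PTSymmetric (c • v.1) ∧ PTSymmetric (c • v.2) := by
  obtain ⟨hv0, hvm, hve⟩ := hv
  obtain ⟨hm, he⟩ := jacobian_ptTransform hL₀ hV hPT hWb hW hΦb hΦ ⟨v, hvm⟩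
  have hcl : conj lam = -lam := by
    apply Complex.ext <;> simp [hlam]
  have he' : jacobian L₀ W γ μ g Φ ⟨_, hm⟩
      = (-I * lam) • sigma3 (ptTransform v.1, ptTransform v.2) := by
    rw [he, hve]
    simp only [sigma3_apply, Prod.smul_mk, map_smulₛₗ, map_mul, map_neg, conj_I, hcl, neg_neg,
      mul_neg, neg_mul]
  obtain ⟨c, hc⟩ := hsimple.exists_smul_eq (y := ⟨v, hvm⟩) (u := ⟨_, hm⟩) hv0
    (IsEigenvector.stabilityOperator_apply hvm hve) (IsEigenvector.stabilityOperator_apply hm he')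
  have hc1 : ptTransform v.1 = c • v.1 := (congrArg Prod.fst hc).symm
  have hc2 : ptTransform v.2 = c • v.2 := (congrArg Prod.snd hc).symm
  -- the `PT` transform is an involution, so that `|c|² = 1`
  have hcc : conj c * c = 1 := by
    have h1 : (conj c * c) • v.1 = (1 : ℂ) • v.1 := by
      rw [mul_smul, ← hc1, ← map_smulₛₗ, ← hc1, ptTransform_ptTransform, one_smul]
    have h2 : (conj c * c) • v.2 = (1 : ℂ) • v.2 := by
      rw [mul_smul, ← hc2, ← map_smulₛₗ, ← hc2, ptTransform_ptTransform, one_smul]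
    exact smul_left_injective ℂ hv0 (Prod.ext h1 h2)
  -- the normalising constant is a square root of `c`
  obtain ⟨d, hd⟩ := IsAlgClosed.exists_eq_mul_self c
  have hdn : ‖d‖ = 1 := by
    have h : ‖conj c * c‖ = 1 := by rw [hcc, norm_one]
    rw [norm_mul, Complex.norm_conj, hd, norm_mul] at h
    have : ‖d‖ ^ 4 = 1 := by linear_combination h
    exact (pow_eq_one_iff_of_nonneg (norm_nonneg d) (by norm_num)).1 this
  have hdc : conj d * c = d := by
    have h : conj d * d = 1 := by
      rw [mul_comm, Complex.mul_conj, Complex.normSq_eq_norm_sq, hdn]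
      norm_num
    rw [hd]
    linear_combination d * h
  refine ⟨d, hdn, ptSymmetric_iff.2 ?_, ptSymmetric_iff.2 ?_⟩
  · rw [map_smulₛₗ, hc1, smul_smul, hdc]
  · rw [map_smulₛₗ, hc2, smul_smul, hdc]

/-- The Krein quantity as a bounded linear functional of its first argument. -/
noncomputable def kreinFunctional (w : L2 × L2) : (L2 × L2) →L[ℂ] ℂ :=
  (innerSL ℂ w.1).comp (.fst ℂ L2 L2) - (innerSL ℂ w.2).comp (.snd ℂ L2 L2)

theorem kreinFunctional_apply (w v : L2 × L2) :
    kreinFunctional w v = inner ℂ w.1 v.1 - inner ℂ w.2 v.2 := rfl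

theorem kreinQuantity_eq (v w : L2 × L2) : kreinQuantity v w = kreinFunctional w v := by
  rw [kreinFunctional_apply, L2.inner_def, L2.inner_def,
    ← integral_sub (L2.integrable_inner _ _) (L2.integrable_inner _ _)]
  rfl

theorem kreinFunctional_ne_zero {w : L2 × L2} (hw : w ≠ 0) : kreinFunctional w ≠ 0 := by
  intro h0
  have h : kreinFunctional w (sigma3 w) = 0 := by rw [h0, zero_apply]
  rw [kreinFunctional_apply, sigma3_apply, inner_neg_right, sub_neg_eq_add,
    inner_self_eq_norm_sq_to_K, inner_self_eq_norm_sq_to_K] at h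
  have h' : ‖w.1‖ ^ 2 + ‖w.2‖ ^ 2 = 0 :=
    Complex.ofReal_injective (by push_cast; exact h)
  have h1 : ‖w.1‖ = 0 := by nlinarith [sq_nonneg ‖w.1‖, sq_nonneg ‖w.2‖]
  have h2 : ‖w.2‖ = 0 := by nlinarith [sq_nonneg ‖w.1‖, sq_nonneg ‖w.2‖]
  exact hw (Prod.ext (norm_eq_zero.1 h1) (norm_eq_zero.1 h2))

/-- For an eigenvector `w` of the adjoint problem, `σ₃w` is a left eigenvector of the stability
operator, with the eigenvalue `-conj λ`. -/
theorem kreinFunctional_stabilityOperator {V W : ℝ → ℝ} {L₀ : L2 →ₗ.[ℂ] L2} {Φ : L2} {γ μ g : ℝ}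
    (hL₀ : IsSchrodingerOperator V L₀) (hWb : MemLp W ∞ volume) (hΦb : MemLp Φ ∞ volume)
    {lam : ℂ} {w : L2 × L2} (hw : IsEigenvector (jacobianAdj L₀ W γ μ g Φ) lam w)
    (u : (stabilityOperator (jacobian L₀ W γ μ g Φ)).domain) :
    kreinFunctional w (stabilityOperator (jacobian L₀ W γ μ g Φ) u)
      = -conj lam * kreinFunctional w u := by
  obtain ⟨-, hwm, hwe⟩ := hw
  have h := inner_jacobian hL₀ hWb hΦb u ⟨w, hwm⟩
  rw [hwe] at h
  change kreinFunctional w (I • sigma3 (jacobian L₀ W γ μ g Φ u)) = _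
  rw [map_smul, kreinFunctional_apply, kreinFunctional_apply, sigma3_apply, inner_neg_right,
    sub_neg_eq_add, h, sigma3_apply, Prod.smul_mk, inner_smul_left, inner_smul_left,
    inner_neg_left, map_mul, map_neg, conj_I, smul_eq_mul]
  linear_combination (conj lam * (inner ℂ w.1 u.1.1 - inner ℂ w.2 u.1.2)) * I_mul_I

/-- The Krein quantity of `PT`-symmetric pairs is real: the reflection `x ↦ -x` conjugates the
integrand. -/
theorem kreinQuantity_im_eq_zero {v w : L2 × L2} (hv1 : PTSymmetric v.1) (hv2 : PTSymmetric v.2)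
    (hw1 : PTSymmetric w.1) (hw2 : PTSymmetric w.2) : (kreinQuantity v w).im = 0 := by
  refine Complex.conj_eq_iff_im.1 ?_
  unfold kreinQuantity
  rw [← integral_conj, ← integral_neg_eq_self]
  refine integral_congr_ae ?_
  filter_upwards [hv1, hv2, hw1, hw2] with x h1 h2 h3 h4
  rw [h1, h2, h3, h4]
  simp only [map_sub, map_mul]

end KreinPT

theorem lemma4
    (V W : ℝ → ℝ) (γ μ g : ℝ) (L₀ : KreinPT.L2 →ₗ.[ℂ] KreinPT.L2) (Φ : KreinPT.L2)
    -- real potentials, `V` even and `W` odd, and the sign `g = ±1`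
    (hVmeas : Measurable V) (hWmeas : Measurable W)
    (hV : ∀ x, V (-x) = V x) (hW : ∀ x, W (-x) = -W x)
    (hg : g = 1 ∨ g = -1)
    -- `L₀` is a self-adjoint realization of `-∂ₓ² + V` with a `PT`-invariant domain
    (hL₀ : KreinPT.IsSchrodingerOperator V L₀) (hPT : KreinPT.PTInvariant L₀.domain)
    -- `W` is exponentially decaying
    (hWdecay : ∃ C κ : ℝ, 0 < C ∧ 0 < κ ∧ ∀ x, |W x| ≤ C * Real.exp (-κ * |x|))
    -- `Φ` is a decaying `PT`-symmetric stationary state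
    (hΦ : KreinPT.IsStationaryState L₀ W γ μ g Φ)
    -- a nonzero simple isolated eigenvalue of both spectral problems, and eigenvectors
    (lam : ℂ) (hlam : lam ≠ 0)
    (hsimple : KreinPT.IsSimpleIsolatedEigenvalue
      (KreinPT.stabilityOperator (KreinPT.jacobian L₀ W γ μ g Φ)) lam)
    (hsimpleAdj : KreinPT.IsSimpleIsolatedEigenvalue
      (KreinPT.stabilityOperator (KreinPT.jacobianAdj L₀ W γ μ g Φ)) lam)
    (v w : KreinPT.L2 × KreinPT.L2)
    (hv : KreinPT.IsEigenvector (KreinPT.jacobian L₀ W γ μ g Φ) lam v)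
    (hw : KreinPT.IsEigenvector (KreinPT.jacobianAdj L₀ W γ μ g Φ) lam w) :
    (lam.re = 0 →
      -- both eigenvectors can be `PT`-normalised
      (∃ c : ℂ, ‖c‖ = 1 ∧ KreinPT.PTSymmetric (c • v.1) ∧ KreinPT.PTSymmetric (c • v.2)) ∧
      (∃ c : ℂ, ‖c‖ = 1 ∧ KreinPT.PTSymmetric (c • w.1) ∧ KreinPT.PTSymmetric (c • w.2)) ∧
      -- the Krein quantity of `PT`-normalised eigenvectors is real
      (KreinPT.PTSymmetric v.1 → KreinPT.PTSymmetric v.2 →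
        KreinPT.PTSymmetric w.1 → KreinPT.PTSymmetric w.2 →
        (KreinPT.kreinQuantity v w).im = 0) ∧
      KreinPT.kreinQuantity v w ≠ 0) ∧
    (lam.re ≠ 0 → KreinPT.kreinQuantity v w = 0) := by
  have hWb : MemLp W ∞ volume := KreinPT.memLp_top_of_le_exp hWmeas.aestronglyMeasurable
    (hWdecay.imp fun C h => h.imp fun κ h => ⟨h.1, h.2.1, .of_forall h.2.2⟩)
  have hΦb : MemLp Φ ∞ volume :=
    KreinPT.memLp_top_of_le_exp (Lp.aestronglyMeasurable Φ) hΦ.decay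
  have hleft := KreinPT.kreinFunctional_stabilityOperator hL₀ hWb hΦb hw
  obtain ⟨hv0, hvm, hve⟩ := id hv
  have hv' := KreinPT.IsEigenvector.stabilityOperator_apply hvm hve
  refine ⟨fun hre => ⟨?_, ?_, KreinPT.kreinQuantity_im_eq_zero, ?_⟩, fun hre => ?_⟩
  · exact hv.exists_ptSymmetric hL₀ hV hPT hWb hW hΦb hΦ.symm hre hsimple
  · exact hw.exists_ptSymmetric hL₀ hV hPT hWb hW hΦb hΦ.symm hre hsimpleAdj
  · have hcl : -conj lam = lam := by
      apply Complex.ext <;> simp [hre]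
    rw [KreinPT.kreinQuantity_eq]
    refine hsimple.apply_ne_zero (y := ⟨v, hvm⟩) hv0 hv' (KreinPT.kreinFunctional_ne_zero hw.1)
      fun u => ?_
    rw [hleft, hcl]
  · -- the right and the left eigenvalue, `λ` and `-conj λ`, differ by `2 Re λ`
    have h := hleft ⟨v, hvm⟩
    rw [hv', map_smul, smul_eq_mul, ← sub_eq_zero, ← sub_mul, sub_neg_eq_add,
      Complex.add_conj] at h
    rw [KreinPT.kreinQuantity_eq]
    refine (mul_eq_zero.1 h).resolve_left ?_
    exact_mod_cast mul_ne_zero two_ne_zero hre
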